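/- Theorem 4.1 (Nonautonomous Grobman–Hartman theorem). Let $X$ be a Banach space and let $(A_m)_{m\in\mathbb Z}$ be a sequence of invertible bounded linear operators on $X$ with $\sup_m\|A_m\|<\infty$. Put $\mathcal A(m,n)=A_{m-1}\cdots A_n$ for $m>n$, $\mathcal A(n,n)=\mathrm{Id}$ and $\mathcal A(m,n)=A_m^{-1}\cdots A_{n-1}^{-1}$ for $m<n$, and assume that $(A_m)$ admits an exponential dichotomy: there are bounded projections $P_m$ on $X$ with $P_{m+1}A_m=A_mP_m$ for all $m\in\mathbb Z$, and constants $C,\lambda>0$, such that $\|\mathcal A(m,n)P_n\|\le Ce^{-\lambda(m-n)}$ for $m\ge n$ and $\|\mathcal A(m,n)(\mathrm{Id}-P_n)\|\le Ce^{-\lambda(n-m)}$ for $m\le n$. Call $c>0$ a robustness constant of $(A_m)$ if there is $K>0$ such that, for every sequence $(B_m)_{m\in\mathbb Z}$ of bounded linear operators on $X$ with $\sup_m\|A_m-B_m\|\le c$, the operator $\mathrm{Id}-\mathbb B$ on $\ell^\infty(\mathbb Z,X)$, where $(\mathbb B\mathbf x)_n=B_{n-1}x_{n-1}$, is invertible with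 $\|(\mathrm{Id}-\mathbb B)^{-1}\|\le K$. Then $(A_m)$ has a robustness constant. Moreover, for every robustness constant $c$ and all $D,r>0$ there are $L>0$ and $\varepsilon_0>0$ such that the following holds for every $\varepsilon\in(0,\varepsilon_0]$ and $\delta=L\varepsilon$. Let $g_n\colon X\to X$, $n\in\mathbb Z$, be differentiable maps with $$\|g_n(x)\|\le\delta,\qquad \|d_xg_n\|\le \frac c2,\qquad \|d_xg_n-d_yg_n\|\le D\|x-y\|^r\qquad (x,y\in X,\ n\in\mathbb Z),$$ and let $G_n=A_n+g_n$. (a) If $\sup_m\|A_m^{-1}\|<\infty$, then every $G_n$ is a homeomorphism of $X$. (b) If every $G_n$ is a homeomorphism of $X$, then there is a unique sequence of homeomorphisms $h_m\colon X\to X$, $m\in\mathbb Z$, such that for each $m\in\mathbb Z$ $$h_{m+1}\circ G_m=A_m\circ h_m\qquad\text{and}\qquad \sup_{x\in X}\|h_m(x)-x\|\le\varepsilon .$$ -/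

import Mathlib

open scoped ENNReal

/-- The product `A_{n+k-1} ⋯ A_n` (the identity for `k = 0`). -/
def forwardProd {X : Type*} [NormedAddCommGroup X] [NormedSpace ℝ X]
    (A : ℤ → X ≃L[ℝ] X) (n : ℤ) : ℕ → X ≃L[ℝ] X
  | 0 => ContinuousLinearEquiv.refl ℝ X
  | k + 1 => (forwardProd A n k).trans (A (n + k))

/-- The evolution family `𝒜(m, n)` of `x_{m+1} = A_m x_m`: it is `A_{m-1} ⋯ A_n` for `m > n`, the
identity for `m = n`, and `A_m⁻¹ ⋯ A_{n-1}⁻¹ = (A_{n-1} ⋯ A_m)⁻¹` for `m < n`. -/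
def evolution {X : Type*} [NormedAddCommGroup X] [NormedSpace ℝ X]
    (A : ℤ → X ≃L[ℝ] X) (m n : ℤ) : X ≃L[ℝ] X :=
  if n ≤ m then forwardProd A n (m - n).toNat else (forwardProd A m (n - m).toNat).symm

/-- The sequence `(A_m)` of invertible bounded operators admits an exponential dichotomy. -/
def HasExponentialDichotomy {X : Type*} [NormedAddCommGroup X] [NormedSpace ℝ X]
    (A : ℤ → X ≃L[ℝ] X) : Prop :=
  ∃ P : ℤ → X →L[ℝ] X,
    (∀ m, P m ∘L P m = P m) ∧
    (∀ m, P (m + 1) ∘L (A m : X →L[ℝ] X) = (A m : X →L[ℝ] X) ∘L P m) ∧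
    ∃ C > 0, ∃ lam > 0,
      (∀ m n : ℤ, n ≤ m →
        ‖(evolution A m n : X →L[ℝ] X) ∘L P n‖ ≤ C * Real.exp (-lam * ((m : ℝ) - (n : ℝ)))) ∧
      (∀ m n : ℤ, m ≤ n →
        ‖(evolution A m n : X →L[ℝ] X) ∘L (ContinuousLinearMap.id ℝ X - P n)‖
          ≤ C * Real.exp (-lam * ((n : ℝ) - (m : ℝ))))

/-- For a bounded sequence `(B_m)` of bounded operators, the bounded operator `𝔹` on the Banach
space `ℓ^∞(ℤ, X)` given by `(𝔹 x)_n = B_{n-1} x_{n-1}`. -/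
noncomputable def shiftOperator {X : Type*} [NormedAddCommGroup X] [NormedSpace ℝ X]
    (B : ℤ → X →L[ℝ] X) (hB : BddAbove (Set.range fun m => ‖B m‖)) :
    lp (fun _ : ℤ => X) ∞ →L[ℝ] lp (fun _ : ℤ => X) ∞ :=
  have key : ∀ M : ℝ, (∀ m, ‖B m‖ ≤ M) → ∀ (x : lp (fun _ : ℤ => X) ∞) (n : ℤ),
      ‖B (n - 1) (x (n - 1))‖ ≤ M * ‖x‖ := fun M hM x n =>
    (B (n - 1)).le_of_opNorm_le_of_le (hM _) (lp.norm_apply_le_norm ENNReal.top_ne_zero x _)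
  have bound : ∃ M : ℝ, ∀ m, ‖B m‖ ≤ M :=
    hB.imp fun _ hM m => hM (Set.mem_range_self m)
  LinearMap.mkContinuousOfExistsBound
    { toFun := fun x => ⟨fun n => B (n - 1) (x (n - 1)), memℓp_infty <| by
        obtain ⟨M, hM⟩ := bound
        refine ⟨M * ‖x‖, ?_⟩
        rintro _ ⟨n, rfl⟩
        exact key M hM x n⟩
      map_add' := fun x y => by ext n; exact map_add (B (n - 1)) _ _
      map_smul' := fun a x => by ext n; simp }
    (by
      obtain ⟨M, hM⟩ := bound
      refine ⟨M, fun x => lp.norm_le_of_forall_le ?_ fun n => key M hM x n⟩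
      exact mul_nonneg ((norm_nonneg _).trans (hM 0)) (norm_nonneg _))

/-- `c > 0` is a robustness constant of `(A_m)`: there is `K > 0` such that for every sequence
`(B_m)` of bounded operators with `sup_m ‖A_m - B_m‖ ≤ c`, the operator `Id - 𝔹` is invertible on
`ℓ^∞(ℤ, X)`, with an inverse of norm at most `K`. -/
def IsRobustnessConstant {X : Type*} [NormedAddCommGroup X] [NormedSpace ℝ X]
    (A : ℤ → X ≃L[ℝ] X) (c : ℝ) : Prop :=
  0 < c ∧ ∃ K > 0, ∀ (B : ℤ → X →L[ℝ] X) (hB : BddAbove (Set.range fun m => ‖B m‖)),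
    (∀ m, ‖(A m : X →L[ℝ] X) - B m‖ ≤ c) →
      ∃ R : lp (fun _ : ℤ => X) ∞ →L[ℝ] lp (fun _ : ℤ => X) ∞,
        R * (1 - shiftOperator B hB) = 1 ∧ (1 - shiftOperator B hB) * R = 1 ∧ ‖R‖ ≤ K

/-!
The dichotomy gives a Green kernel `Γ m j`, which decays exponentially in `|m - j|` and inverts the
difference operator `y ↦ (y_{m+1} - A_m y_m)` on bounded sequences. More generally, let a
homeomorphism `Φ` of a space `Y` raise a time function `τ : Y → ℤ` by one. Then the equation
`w (Φ p) = A_{τ p} (w p) + u p`, with bounded `u`, has exactly one bounded solution: the sum of `Γ`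
against `u` along the orbit of `p` (`IsGreenKernel.greenSum_apply_map`,
`IsGreenKernel.eq_greenSum`). It is continuous if `u` is, and its norm is at most `∑ b` times that
of `u`.

* For `Y = ℤ` this says that `Id - 𝔸` is bijective on `ℓ^∞`, so that its inverse is bounded, and a
  Neumann series shows that operators close to it stay invertible with controlled inverses.
* By interpolation (`exists_norm_fderiv_le_of_norm_le`), a uniform bound on `g` and the Hölder bound
  on its derivative make the Lipschitz constant of `g` as small as desired once `ε₀` is small. This
  is where `D` and `r` enter, and it replaces the bound `c / 2` on the derivative. The maps
  `A_n + g_n` are then homeomorphisms as small Lipschitz perturbations of `A_n`.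
* For `Y = ℤ × X`, with `Φ` the skew product over the perturbed dynamics, the conjugacy equation for
  `h = Id + e` is linear in `e`, so `e` exists, is unique and continuous. A candidate inverse
  `Id + f` solves a nonlinear equation over the linear dynamics, by the contraction principle. That
  the two are mutually inverse follows from the uniqueness of bounded solutions, in the form
  `IsGreenKernel.eq_zero_of_norm_le`.
-/

open scoped NNReal

/-! ### The evolution family -/

section Evolution

variable {X : Type*} [NormedAddCommGroup X] [NormedSpace ℝ X] (A : ℤ → X ≃L[ℝ] X)

lemma forwardProd_succ_apply' (m : ℤ) (k : ℕ) (x : X) :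
    forwardProd A m (k + 1) x = forwardProd A (m + 1) k (A m x) := by
  induction k with
  | zero => simp [forwardProd]
  | succ k ih =>
    have h : forwardProd A m (k + 1 + 1) x
        = A (m + ((k + 1 : ℕ) : ℤ)) (forwardProd A m (k + 1) x) := rfl
    have h' : forwardProd A (m + 1) (k + 1) (A m x)
        = A (m + 1 + (k : ℤ)) (forwardProd A (m + 1) k (A m x)) := rfl
    rw [h, h', ih, show m + ((k + 1 : ℕ) : ℤ) = m + 1 + (k : ℤ) by push_cast; ring]

lemma evolution_self_apply (n : ℤ) (x : X) : evolution A n n x = x := by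
  simp [evolution, forwardProd]

lemma evolution_of_ge {m n : ℤ} (h : m ≤ n) :
    evolution A m n = (forwardProd A m (n - m).toNat).symm := by
  rcases h.eq_or_lt with rfl | h
  · simp [evolution, forwardProd]
  · simp [evolution, not_le.2 h]

lemma evolution_succ_left (m n : ℤ) (x : X) :
    evolution A (m + 1) n x = A m (evolution A m n x) := by
  rcases le_or_gt n m with h | h
  · obtain ⟨k, rfl⟩ := Int.le.dest h
    have h1 : n ≤ n + (k : ℤ) + 1 := by omega
    have h2 : (n + (k : ℤ) + 1 - n).toNat = k + 1 := by omega
    simp [evolution, h1, h2, forwardProd]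
  · obtain ⟨k, rfl⟩ := Int.le.dest (show m + 1 ≤ n by omega)
    rw [evolution_of_ge A (by omega), evolution_of_ge A (by omega),
      show (m + 1 + (k : ℤ) - (m + 1)).toNat = k by omega,
      show (m + 1 + (k : ℤ) - m).toNat = k + 1 by omega]
    rw [ContinuousLinearEquiv.symm_apply_eq, ← forwardProd_succ_apply',
      ContinuousLinearEquiv.apply_symm_apply]

lemma evolution_succ_right (m n : ℤ) (x : X) :
    evolution A m (n + 1) (A n x) = evolution A m n x := by
  -- As functions of `m`, both sides solve `x_{m+1} = A_m x_m`, and they agree at `m = n + 1`.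
  induction m using Int.inductionOn' (b := n + 1) with
  | zero => rw [evolution_self_apply, evolution_succ_left, evolution_self_apply]
  | succ k _ ih => rw [evolution_succ_left, evolution_succ_left, ih]
  | pred k _ ih =>
    apply (A (k - 1)).injective
    rw [← evolution_succ_left, ← evolution_succ_left, sub_add_cancel, ih]

end Evolution

/-! ### Green kernels -/

section Green

variable {X : Type*} [NormedAddCommGroup X] [NormedSpace ℝ X]

/-- `Γ` is a Green kernel of `y_{m+1} = A_m y_m + z_m`: formally, `y_m = ∑ j, Γ m j z_j` is the
bounded solution. The fields `left` and `right` say that this formula is a right and a left inverse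
of the difference operator; `b` is a summable bound, as a function of the distance `k` between the
two times, which makes the series converge uniformly. -/
structure IsGreenKernel (A : ℤ → X ≃L[ℝ] X) (Γ : ℤ → ℤ → X →L[ℝ] X) (b : ℤ → ℝ) : Prop where
  summable : Summable b
  norm_le : ∀ m k, ‖Γ m (m + k)‖ ≤ b k
  left : ∀ m j x, A m (Γ m j x) = Γ (m + 1) j x - if j = m then x else 0
  right : ∀ m j x, Γ m j (A j x) = Γ m (j - 1) x - if j = m then x else 0

lemma summable_exp_neg_abs_int {lam : ℝ} (hlam : 0 < lam) :
    Summable fun k : ℤ => Real.exp (-lam * |(k : ℝ)|) := by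
  have h : Summable fun n : ℕ => Real.exp (-lam * (n : ℝ)) := by
    have := Real.summable_exp_nat_mul_iff.2 (neg_lt_zero.2 hlam)
    exact this.congr fun n => by rw [mul_comm]
  exact Summable.of_nat_of_neg (by simpa using h) (by simpa using h)

/-- The classical Green kernel: `𝒜(m, j+1) P_{j+1}` for sources `j` in the past of `m`, and
`-𝒜(m, j+1) (Id - P_{j+1})` for the others. -/
theorem HasExponentialDichotomy.exists_isGreenKernel {A : ℤ → X ≃L[ℝ] X}
    (hA : HasExponentialDichotomy A) : ∃ Γ b, IsGreenKernel A Γ b := by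
  obtain ⟨P, -, hPA, C, hC, lam, hlam, hs, hu⟩ := hA
  have hPA' : ∀ m x, P (m + 1) (A m x) = A m (P m x) := fun m x =>
    DFunLike.congr_fun (hPA m) x
  refine ⟨fun m j => if j < m then (evolution A m (j + 1) : X →L[ℝ] X) ∘L P (j + 1)
      else -((evolution A m (j + 1) : X →L[ℝ] X) ∘L (ContinuousLinearMap.id ℝ X - P (j + 1))),
    fun k => C * Real.exp (-lam * |((k + 1 : ℤ) : ℝ)|), ?_, ?_, ?_, ?_⟩
  · exact (((Equiv.addRight (1 : ℤ)).summable_iff).2 (summable_exp_neg_abs_int hlam)).mul_left C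
  · intro m k
    split_ifs with h
    · have hk : k + 1 ≤ 0 := by omega
      refine (hs m (m + k + 1) (by omega)).trans (le_of_eq ?_)
      rw [abs_of_nonpos (by exact_mod_cast hk)]
      push_cast
      ring_nf
    · have hk : 0 ≤ k + 1 := by omega
      rw [norm_neg]
      refine (hu m (m + k + 1) (by omega)).trans (le_of_eq ?_)
      rw [abs_of_nonneg (by exact_mod_cast hk)]
      push_cast
      ring_nf
  · intro m j x
    rcases lt_trichotomy j m with h | rfl | h
    · simp [h, h.ne, show j < m + 1 by omega, evolution_succ_left]
    · simp [← evolution_succ_left, evolution_self_apply]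
    · simp [h.ne', not_lt.2 h.le, show ¬ j < m + 1 by omega, ← evolution_succ_left]
  · intro m j x
    rcases lt_trichotomy j m with h | rfl | h
    · simp [h, h.ne, show j - 1 < m by omega, hPA', evolution_succ_right]
    · simp [hPA', evolution_succ_right, evolution_self_apply]
    · simp [h.ne', not_lt.2 h.le, show ¬ j - 1 < m by omega, hPA', evolution_succ_right]

/-- The solution `w` of `w (Φ p) = A_{τ p} (w p) + u p` given by a Green kernel, where the
homeomorphism `Φ` advances the time `τ` by one: along the orbit of `p`, it is the sum of the kernel
against the source `u`. -/
noncomputable def greenSum {Y : Type*} [TopologicalSpace Y] (Γ : ℤ → ℤ → X →L[ℝ] X) (τ : Y → ℤ)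
    (Φ : Y ≃ₜ Y) (u : Y → X) (p : Y) : X :=
  ∑' k : ℤ, Γ (τ p) (τ p + k) (u ((Φ ^ k) p))

namespace IsGreenKernel

variable {A : ℤ → X ≃L[ℝ] X} {Γ : ℤ → ℤ → X →L[ℝ] X} {b : ℤ → ℝ}
  {Y : Type*} [TopologicalSpace Y] {τ : Y → ℤ} {Φ : Y ≃ₜ Y} {u v w : Y → X} {B : ℝ}

lemma bound_nonneg (hΓ : IsGreenKernel A Γ b) (k : ℤ) : 0 ≤ b k :=
  (norm_nonneg _).trans (hΓ.norm_le 0 k)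

lemma norm_apply_le (hΓ : IsGreenKernel A Γ b) (m k : ℤ) {x : X} (hx : ‖x‖ ≤ B) :
    ‖Γ m (m + k) x‖ ≤ b k * B :=
  (Γ m (m + k)).le_of_opNorm_le_of_le (hΓ.norm_le m k) hx

lemma norm_greenSum_le (hΓ : IsGreenKernel A Γ b) (hu : ∀ p, ‖u p‖ ≤ B) (p : Y) :
    ‖greenSum Γ τ Φ u p‖ ≤ (∑' k, b k) * B := by
  rw [← tsum_mul_right]
  exact tsum_of_norm_bounded (hΓ.summable.mul_right B).hasSum
    fun k => hΓ.norm_apply_le (τ p) k (hu _)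

lemma continuous_greenSum [CompleteSpace X] (hΓ : IsGreenKernel A Γ b) (hτ : Continuous τ)
    (huc : Continuous u) (hu : ∀ p, ‖u p‖ ≤ B) : Continuous (greenSum Γ τ Φ u) := by
  refine continuous_tsum (fun k => ?_) (hΓ.summable.mul_right B)
    fun k p => hΓ.norm_apply_le (τ p) k (hu _)
  have h : Continuous fun m : ℤ => Γ m (m + k) := continuous_of_discreteTopology
  exact (h.comp hτ).clm_apply (huc.comp (Φ ^ k).continuous)

variable [CompleteSpace X]

lemma summable_greenSum (hΓ : IsGreenKernel A Γ b) (hu : ∀ p, ‖u p‖ ≤ B) (m : ℤ) (p : Y) :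
    Summable fun k : ℤ => Γ m (m + k) (u ((Φ ^ k) p)) :=
  (hΓ.summable.mul_right B).of_norm_bounded fun k => hΓ.norm_apply_le m k (hu _)

lemma greenSum_sub (hΓ : IsGreenKernel A Γ b) (hu : ∀ p, ‖u p‖ ≤ B) {B' : ℝ}
    (hv : ∀ p, ‖v p‖ ≤ B') (p : Y) :
    greenSum Γ τ Φ u p - greenSum Γ τ Φ v p = greenSum Γ τ Φ (fun q => u q - v q) p := by
  rw [greenSum, greenSum,
    ← (hΓ.summable_greenSum hu _ _).tsum_sub (hΓ.summable_greenSum hv _ _)]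
  simp [greenSum]

/-- The Green sum solves the cohomological equation. -/
lemma greenSum_apply_map (hΓ : IsGreenKernel A Γ b) (hΦ : ∀ p, τ (Φ p) = τ p + 1)
    (hu : ∀ p, ‖u p‖ ≤ B) (p : Y) :
    greenSum Γ τ Φ u (Φ p) = A (τ p) (greenSum Γ τ Φ u p) + u p := by
  have hs := hΓ.summable_greenSum (Φ := Φ) hu (τ p) p
  have hs0 : HasSum (fun k : ℤ => if k = 0 then u p else 0) (u p) := hasSum_ite_eq 0 (u p)
  have h1 := ((A (τ p) : X →L[ℝ] X).hasSum hs.hasSum).add hs0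
  have h2 : HasSum (fun k : ℤ => Γ (τ p + 1) (τ p + k) (u ((Φ ^ k) p)))
      (A (τ p) (greenSum Γ τ Φ u p) + u p) := by
    refine h1.congr_fun fun k => ?_
    simp only [ContinuousLinearEquiv.coe_coe, hΓ.left]
    rcases eq_or_ne k 0 with rfl | hk <;> simp [*]
  rw [← h2.tsum_eq, greenSum, ← (Equiv.addRight (1 : ℤ)).tsum_eq
    fun k : ℤ => Γ (τ p + 1) (τ p + k) (u ((Φ ^ k) p))]
  refine tsum_congr fun k => ?_
  rw [hΦ, Equiv.coe_addRight, zpow_add_one, Homeomorph.mul_apply,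
    show τ p + 1 + k = τ p + (k + 1) by ring]

lemma time_zpow (hΦ : ∀ p, τ (Φ p) = τ p + 1) (k : ℤ) (p : Y) : τ ((Φ ^ k) p) = τ p + k := by
  induction k using Int.induction_on with
  | zero => simp
  | succ k ih => rw [add_comm, zpow_add, zpow_one, Homeomorph.mul_apply, hΦ, ih]; ring
  | pred k ih =>
    have h := hΦ ((Φ ^ (-(k : ℤ) - 1)) p)
    rw [← Homeomorph.mul_apply, ← zpow_one_add, add_sub_cancel, ih] at h
    linarith

/-- The Green sum is the only bounded solution of the cohomological equation. -/
lemma eq_greenSum (hΓ : IsGreenKernel A Γ b) (hΦ : ∀ p, τ (Φ p) = τ p + 1)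
    (hw : ∀ p, ‖w p‖ ≤ B) (h : ∀ p, w (Φ p) = A (τ p) (w p) + u p) (p : Y) :
    w p = greenSum Γ τ Φ u p := by
  have hs : Summable fun k : ℤ => Γ (τ p) (τ p + (k - 1)) (w ((Φ ^ k) p)) := by
    have := hΓ.summable_greenSum (u := fun q => w (Φ q)) (Φ := Φ) (fun q => hw _) (τ p) p
    refine (((Equiv.subRight (1 : ℤ)).summable_iff).2 this).congr fun k => ?_
    simp only [Function.comp, Equiv.subRight_apply]
    rw [← Homeomorph.mul_apply, ← zpow_one_add, add_sub_cancel]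
  have hs1 := ((Equiv.addRight (1 : ℤ)).hasSum_iff).2 hs.hasSum
  have hs0 : HasSum (fun k : ℤ => if k = 0 then w p else 0) (w p) := hasSum_ite_eq 0 (w p)
  -- The series telescopes, except for the jump of the kernel at `k = 0`.
  have h1 := (hs1.sub hs.hasSum).add hs0
  rw [sub_self, zero_add] at h1
  rw [greenSum, ← h1.tsum_eq]
  refine tsum_congr fun k => ?_
  have hu : u ((Φ ^ k) p) = w ((Φ ^ (k + 1)) p) - A (τ p + k) (w ((Φ ^ k) p)) := by
    rw [add_comm k 1, zpow_one_add, Homeomorph.mul_apply, h, time_zpow hΦ]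
    abel
  rw [hu, map_sub, hΓ.right]
  simp only [Function.comp, Equiv.coe_addRight, add_sub_cancel_right, ← add_sub_assoc,
    add_eq_left]
  split_ifs with hk
  · subst hk
    simp only [zpow_zero, Homeomorph.one_apply]
    abel
  · abel

end IsGreenKernel

end Green

/-! ### Robustness constants -/

section Robustness

/-- A quantitative form of openness of the invertible elements; it also covers the zero ring, where
the inverse has norm zero. -/
lemma exists_inverse_of_norm_mul_norm_sub_le {R : Type*} [NormedRing R] [CompleteSpace R]
    {T S T' : R} (h₁ : T' * T = 1) (h₂ : T * T' = 1) (h : ‖T'‖ * ‖T - S‖ ≤ 1 / 2) :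
    ∃ S' : R, S' * S = 1 ∧ S * S' = 1 ∧ ‖S'‖ ≤ 2 * ‖T'‖ := by
  have hlt : ‖T' * (T - S)‖ < 1 := (norm_mul_le _ _).trans_lt (h.trans_lt (by norm_num))
  set U := Units.oneSub (T' * (T - S)) hlt with hU
  have hUv : (U : R) = T' * S := by
    rw [hU, Units.val_oneSub, mul_sub, h₁]
    abel
  have hS : S = T * U := by rw [hUv, ← mul_assoc, h₂, one_mul]
  have hl : (↑U⁻¹ * T') * S = 1 := by rw [mul_assoc, ← hUv, Units.inv_mul]
  refine ⟨↑U⁻¹ * T', hl, ?_, ?_⟩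
  · rw [hS, mul_assoc, ← mul_assoc (U : R), Units.mul_inv, one_mul, h₂]
  · set S' := (↑U⁻¹ : R) * T'
    have hS' : S' = T' + S' * (T - S) * T' := by
      rw [mul_sub, hl, sub_mul, mul_assoc, h₂, mul_one, one_mul]
      abel
    have hle : ‖S' * (T - S) * T'‖ ≤ ‖S'‖ * (1 / 2) := by
      refine (norm_mul_le _ _).trans ((mul_le_mul_of_nonneg_right (norm_mul_le _ _)
        (norm_nonneg _)).trans ?_)
      calc ‖S'‖ * ‖T - S‖ * ‖T'‖ = ‖S'‖ * (‖T'‖ * ‖T - S‖) := by ring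
        _ ≤ _ := by gcongr
    have := norm_add_le T' (S' * (T - S) * T')
    rw [← hS'] at this
    linarith

variable {X : Type*} [NormedAddCommGroup X] [NormedSpace ℝ X]

lemma shiftOperator_apply (B : ℤ → X →L[ℝ] X) (hB : BddAbove (Set.range fun m => ‖B m‖))
    (x : lp (fun _ : ℤ => X) ∞) (n : ℤ) : shiftOperator B hB x n = B (n - 1) (x (n - 1)) := rfl

lemma norm_shiftOperator_sub_le {B B' : ℤ → X →L[ℝ] X}
    (hB : BddAbove (Set.range fun m => ‖B m‖)) (hB' : BddAbove (Set.range fun m => ‖B' m‖))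
    {c : ℝ} (hc : 0 ≤ c) (h : ∀ m, ‖B m - B' m‖ ≤ c) :
    ‖shiftOperator B hB - shiftOperator B' hB'‖ ≤ c := by
  refine ContinuousLinearMap.opNorm_le_bound _ hc fun x =>
    lp.norm_le_of_forall_le (by positivity) fun n => ?_
  exact (B (n - 1) - B' (n - 1)).le_of_opNorm_le_of_le (h _)
    (lp.norm_apply_le_norm ENNReal.top_ne_zero x _)

variable [CompleteSpace X] {A : ℤ → X ≃L[ℝ] X} {Γ : ℤ → ℤ → X →L[ℝ] X} {b : ℤ → ℝ}

lemma IsGreenKernel.bijective_one_sub_shiftOperator (hΓ : IsGreenKernel A Γ b)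
    (hA : BddAbove (Set.range fun m => ‖(A m : X →L[ℝ] X)‖)) :
    Function.Bijective
      ⇑((1 : lp (fun _ : ℤ => X) ∞ →L[ℝ] lp (fun _ : ℤ => X) ∞)
        - shiftOperator (fun m => (A m : X →L[ℝ] X)) hA) := by
  let Φ : ℤ ≃ₜ ℤ := Homeomorph.addRight 1
  have hΦ : ∀ n, (id (Φ n) : ℤ) = id n + 1 := fun n => rfl
  have hb : ∀ (x : lp (fun _ : ℤ => X) ∞) n, ‖x n‖ ≤ ‖x‖ := fun x n =>
    lp.norm_apply_le_norm ENNReal.top_ne_zero x n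
  constructor
  · rw [injective_iff_map_eq_zero]
    intro x hx
    ext n
    have hstep : ∀ n, x (Φ n) = A (id n) (x n) + (0 : X) := fun n => by
      have := congrArg (fun y : lp (fun _ : ℤ => X) ∞ => y (n + 1)) hx
      simpa [shiftOperator_apply, sub_eq_zero, Φ] using this
    rw [hΓ.eq_greenSum hΦ (hb x) hstep]
    simp [greenSum]
  · intro z
    have hz : ∀ n : ℤ, ‖z (Φ n)‖ ≤ ‖z‖ := fun n => hb z _
    refine ⟨⟨greenSum Γ id Φ fun n => z (Φ n), memℓp_infty ⟨(∑' k, b k) * ‖z‖, ?_⟩⟩, ?_⟩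
    · rintro _ ⟨n, rfl⟩
      exact hΓ.norm_greenSum_le hz n
    · ext n
      have := hΓ.greenSum_apply_map hΦ hz (n - 1)
      have hn : Φ (n - 1) = n := sub_add_cancel n 1
      rw [hn] at this
      change greenSum Γ id Φ (fun n => z (Φ n)) n
        - A (n - 1) (greenSum Γ id Φ (fun n => z (Φ n)) (n - 1)) = z n
      rw [this]
      exact add_sub_cancel_left _ _

theorem IsGreenKernel.exists_isRobustnessConstant (hΓ : IsGreenKernel A Γ b)
    (hA : BddAbove (Set.range fun m => ‖(A m : X →L[ℝ] X)‖)) :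
    ∃ c, IsRobustnessConstant A c := by
  set T := 1 - shiftOperator (fun m => (A m : X →L[ℝ] X)) hA with hT
  have hbij := hΓ.bijective_one_sub_shiftOperator hA
  let e := ContinuousLinearEquiv.ofBijective T (LinearMap.ker_eq_bot.2 hbij.1)
    (LinearMap.range_eq_top.2 hbij.2)
  let T' : lp (fun _ : ℤ => X) ∞ →L[ℝ] lp (fun _ : ℤ => X) ∞ := e.symm
  have h₁ : T' * T = 1 := ContinuousLinearMap.ext fun x => e.symm_apply_apply x
  have h₂ : T * T' = 1 := ContinuousLinearMap.ext fun x => e.apply_symm_apply x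
  have hc : 0 < 1 / (2 * (‖T'‖ + 1)) := by positivity
  refine ⟨1 / (2 * (‖T'‖ + 1)), hc, 2 * ‖T'‖ + 1, by positivity, fun B hB h => ?_⟩
  obtain ⟨R, hR₁, hR₂, hR⟩ := exists_inverse_of_norm_mul_norm_sub_le
    (S := 1 - shiftOperator B hB) h₁ h₂ (by
      rw [hT, sub_sub_sub_cancel_left, norm_sub_rev]
      refine (mul_le_mul_of_nonneg_left (norm_shiftOperator_sub_le hA hB hc.le h)
        (norm_nonneg _)).trans ?_
      rw [mul_one_div, div_le_div_iff₀ (by positivity) two_pos]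
      linarith)
  exact ⟨R, hR₁, hR₂, by linarith⟩

end Robustness

/-! ### Smallness of the derivative of the perturbation -/

section Interpolation

variable {X Z : Type*} [NormedAddCommGroup X] [NormedSpace ℝ X]
  [NormedAddCommGroup Z] [NormedSpace ℝ Z]

/-- Interpolation: among maps whose derivatives are Hölder continuous with fixed exponent and
constant, those that are uniformly small have uniformly small derivatives. -/
lemma exists_norm_fderiv_le_of_norm_le {D r η : ℝ} (hD : 0 < D) (hr : 0 < r) (hη : 0 < η) :
    ∃ δ > 0, ∀ g : X → Z, Differentiable ℝ g →
      (∀ x y, ‖fderiv ℝ g x - fderiv ℝ g y‖ ≤ D * ‖x - y‖ ^ r) →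
      (∀ x, ‖g x‖ ≤ δ) → ∀ x, ‖fderiv ℝ g x‖ ≤ η := by
  -- At the scale `t`, the derivative varies by at most `D * t ^ r = η / 2`.
  set t : ℝ := (η / (2 * D)) ^ r⁻¹ with ht_def
  have ht : 0 < t := by positivity
  have htr : D * t ^ r = η / 2 := by
    rw [ht_def, Real.rpow_inv_rpow (by positivity) hr.ne']
    field_simp
  refine ⟨η * t / 4, by positivity, fun g hg hD' hδ x => ?_⟩
  refine ContinuousLinearMap.opNorm_le_of_unit_norm hη.le fun v hv => ?_
  have hbound : ∀ z ∈ Metric.closedBall x t, ‖fderiv ℝ g z - fderiv ℝ g x‖ ≤ η / 2 := by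
    intro z hz
    rw [mem_closedBall_iff_norm] at hz
    refine (hD' z x).trans (htr ▸ ?_)
    gcongr
  have hmem : x + t • v ∈ Metric.closedBall x t := by
    simp [norm_smul, hv, abs_of_pos ht]
  have hmv := Convex.norm_image_sub_le_of_norm_fderiv_le' (fun z _ => hg z) hbound
    (convex_closedBall x t) (Metric.mem_closedBall_self ht.le) hmem
  rw [add_sub_cancel_left, norm_smul, hv, mul_one, Real.norm_of_nonneg ht.le, map_smul] at hmv
  have htri : ‖t • fderiv ℝ g x v‖ ≤ η * t := by
    calc ‖t • fderiv ℝ g x v‖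
        = ‖g (x + t • v) - g x - (g (x + t • v) - g x - t • fderiv ℝ g x v)‖ := by
          rw [sub_sub_cancel]
      _ ≤ ‖g (x + t • v)‖ + ‖g x‖ + ‖g (x + t • v) - g x - t • fderiv ℝ g x v‖ :=
          (norm_sub_le _ _).trans (by gcongr; exact norm_sub_le _ _)
      _ ≤ η * t / 4 + η * t / 4 + η / 2 * t := by
          gcongr
          · exact hδ _
          · exact hδ _
      _ = η * t := by ring
  rw [norm_smul, Real.norm_of_nonneg ht.le, mul_comm] at htri
  exact le_of_mul_le_mul_right htri ht

end Interpolation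

/-! ### Conjugacies -/

section Conjugacy

/-- The homeomorphism `(m, x) ↦ (m + 1, φ_m x)` of `ℤ × X` which turns the nonautonomous dynamics
of `φ` into an autonomous one. -/
def skewProduct {X : Type*} [TopologicalSpace X] (φ : ℤ → X ≃ₜ X) : ℤ × X ≃ₜ ℤ × X where
  toFun p := (p.1 + 1, φ p.1 p.2)
  invFun p := (p.1 - 1, (φ (p.1 - 1)).symm p.2)
  left_inv p := by simp
  right_inv p := by simp
  continuous_toFun := continuous_prod_of_discrete_left.2 fun m =>
    (continuous_const (y := m + 1)).prodMk (φ m).continuous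
  continuous_invFun := continuous_prod_of_discrete_left.2 fun m =>
    (continuous_const (y := m - 1)).prodMk (φ (m - 1)).symm.continuous

variable {X : Type*} [NormedAddCommGroup X] [NormedSpace ℝ X]

lemma isHomeomorph_add_of_norm_sub_le [CompleteSpace X] (A : X ≃L[ℝ] X) {g : X → X} {η : ℝ≥0}
    {a : ℝ} (hg : ∀ x y, ‖g x - g y‖ ≤ η * ‖x - y‖) (ha : ‖(A.symm : X →L[ℝ] X)‖ ≤ a)
    (haη : a * η < 1) : IsHomeomorph fun x => A x + g x := by
  have happrox : ApproximatesLinearOn (fun x => A x + g x) (A : X →L[ℝ] X) Set.univ η :=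
    fun x _ y _ => by simpa [add_sub_add_comm] using hg x y
  have hlt : Subsingleton X ∨ η < ‖(A.symm : X →L[ℝ] X)‖₊⁻¹ := by
    refine (subsingleton_or_nontrivial X).imp_right fun (_ : Nontrivial X) => ?_
    have hpos : 0 < ‖(A.symm : X →L[ℝ] X)‖ := A.norm_symm_pos
    rw [← NNReal.coe_lt_coe, NNReal.coe_inv, coe_nnnorm, ← one_div, lt_div_iff₀ hpos, mul_comm]
    exact (mul_le_mul_of_nonneg_right ha η.2).trans_lt haη
  exact (happrox.toHomeomorph _ hlt).isHomeomorph

variable [CompleteSpace X] {A : ℤ → X ≃L[ℝ] X} {Γ : ℤ → ℤ → X →L[ℝ] X} {b : ℤ → ℝ}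
  {g : ℤ → X → X} {δ ε : ℝ} {η : ℝ≥0}

open BoundedContinuousFunction in
/-- The displacement `f` of a semiconjugacy `Id + f` from the linear dynamics to the perturbed one,
as the fixed point of a contraction of the space of bounded continuous functions on `ℤ × X`. -/
lemma IsGreenKernel.exists_semiconj_linear (hΓ : IsGreenKernel A Γ b)
    (hη : (∑' k, b k) * η ≤ 1 / 2) (hgδ : ∀ n x, ‖g n x‖ ≤ δ)
    (hgη : ∀ n x y, ‖g n x - g n y‖ ≤ η * ‖x - y‖) (hgc : ∀ n, Continuous (g n)) :
    ∃ f : ℤ × X →ᵇ X, ∀ m x, f (m + 1, A m x) = A m (f (m, x)) + g m (x + f (m, x)) := by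
  let Φ : ℤ × X ≃ₜ ℤ × X := skewProduct fun m => (A m).toHomeomorph
  have hΦ : ∀ p, (Φ p).1 = p.1 + 1 := fun p => rfl
  let u : (ℤ × X →ᵇ X) → ℤ × X → X := fun f p => g p.1 (p.2 + f p)
  have hu : ∀ f p, ‖u f p‖ ≤ δ := fun f p => hgδ _ _
  have hgc' : Continuous fun p : ℤ × X => g p.1 p.2 := continuous_prod_of_discrete_left.2 hgc
  have huc : ∀ f, Continuous (u f) := fun f =>
    hgc'.comp (continuous_fst.prodMk (continuous_snd.add f.continuous))
  let F : (ℤ × X →ᵇ X) → (ℤ × X →ᵇ X) := fun f =>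
    ofNormedAddCommGroup (greenSum Γ Prod.fst Φ (u f))
      (hΓ.continuous_greenSum continuous_fst (huc f) (hu f)) _ (hΓ.norm_greenSum_le (hu f))
  have hF : ContractingWith (1 / 2) F := by
    refine ⟨by norm_num, LipschitzWith.of_dist_le_mul fun f f' => ?_⟩
    refine (dist_le (by positivity)).2 fun p => ?_
    rw [dist_eq_norm]
    change ‖greenSum Γ Prod.fst Φ (u f) p - greenSum Γ Prod.fst Φ (u f') p‖ ≤ _
    rw [hΓ.greenSum_sub (hu f) (hu f')]
    have hle : ∀ q, ‖u f q - u f' q‖ ≤ η * dist f f' := fun q => by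
      refine (hgη _ _ _).trans ?_
      rw [add_sub_add_left_eq_sub, ← dist_eq_norm]
      exact mul_le_mul_of_nonneg_left (dist_coe_le_dist q) η.2
    refine (hΓ.norm_greenSum_le hle p).trans ?_
    rw [← mul_assoc, NNReal.coe_div, NNReal.coe_one, NNReal.coe_ofNat]
    exact mul_le_mul_of_nonneg_right hη dist_nonneg
  obtain ⟨f, hf⟩ : ∃ f, F f = f := ⟨_, hF.fixedPoint_isFixedPt⟩
  refine ⟨f, fun m x => ?_⟩
  have hf' : ∀ p, f p = greenSum Γ Prod.fst Φ (u f) p := fun p => (DFunLike.congr_fun hf p).symm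
  have := hΓ.greenSum_apply_map hΦ (hu f) (m, x)
  rwa [← hf', ← hf'] at this

/-- A bounded solution whose source is dominated by a small multiple of the solution itself
vanishes. -/
lemma IsGreenKernel.eq_zero_of_norm_le (hΓ : IsGreenKernel A Γ b) (hη : (∑' k, b k) * η ≤ 1 / 2)
    {Y : Type*} [TopologicalSpace Y] {τ : Y → ℤ} {Φ : Y ≃ₜ Y} (hΦ : ∀ p, τ (Φ p) = τ p + 1)
    {w u : Y → X} {B : ℝ} (hw : ∀ p, ‖w p‖ ≤ B) (h : ∀ p, w (Φ p) = A (τ p) (w p) + u p)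
    (hu : ∀ p, ‖u p‖ ≤ η * ‖w p‖) (p : Y) : w p = 0 := by
  have : Nonempty Y := ⟨p⟩
  have hbdd : BddAbove (Set.range fun p => ‖w p‖) := ⟨B, by rintro _ ⟨q, rfl⟩; exact hw q⟩
  set s := ⨆ p, ‖w p‖
  have hws : ∀ p, ‖w p‖ ≤ s := le_ciSup hbdd
  have hs0 : 0 ≤ s := (norm_nonneg _).trans (hws p)
  have hs : s ≤ 1 / 2 * s := ciSup_le fun q => by
    rw [hΓ.eq_greenSum hΦ hw h q]
    refine (hΓ.norm_greenSum_le
      (fun q => (hu q).trans (mul_le_mul_of_nonneg_left (hws q) η.2)) q).trans ?_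
    rw [← mul_assoc]
    exact mul_le_mul_of_nonneg_right hη hs0
  exact norm_le_zero_iff.1 ((hws p).trans (by linarith))

/-- The conjugacy theorem for bounded perturbations with a small Lipschitz constant. -/
theorem IsGreenKernel.existsUnique_conj (hΓ : IsGreenKernel A Γ b)
    (hη : (∑' k, b k) * η ≤ 1 / 2) (hε : (∑' k, b k) * δ ≤ ε) (hgδ : ∀ n x, ‖g n x‖ ≤ δ)
    (hgη : ∀ n x y, ‖g n x - g n y‖ ≤ η * ‖x - y‖) (hgc : ∀ n, Continuous (g n))
    (hG : ∀ n, IsHomeomorph fun x => A n x + g n x) :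
    ∃! h : ℤ → X ≃ₜ X, ∀ m : ℤ, (∀ x, h (m + 1) (A m x + g m x) = A m (h m x)) ∧
      ∀ x, ‖h m x - x‖ ≤ ε := by
  let Ψ : ℤ × X ≃ₜ ℤ × X := skewProduct fun m => (A m).toHomeomorph
  have hΨ : ∀ p, (Ψ p).1 = p.1 + 1 := fun p => rfl
  let Φ : ℤ × X ≃ₜ ℤ × X := skewProduct fun m => (hG m).homeomorph
  have hΦ : ∀ p, (Φ p).1 = p.1 + 1 := fun p => rfl
  have hΦ' : ∀ p, Φ p = (p.1 + 1, A p.1 p.2 + g p.1 p.2) := fun p => rfl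
  let v : ℤ × X → X := fun p => -g p.1 p.2
  have hv : ∀ p, ‖v p‖ ≤ δ := fun p => by simpa [v] using hgδ p.1 p.2
  have hvc : Continuous v := continuous_prod_of_discrete_left.2 fun m => (hgc m).neg
  obtain ⟨f, hf⟩ := hΓ.exists_semiconj_linear hη hgδ hgη hgc
  set e : ℤ × X → X := greenSum Γ Prod.fst Φ v
  have hec : Continuous e := hΓ.continuous_greenSum continuous_fst hvc hv
  have heε : ∀ p, ‖e p‖ ≤ ε := fun p => (hΓ.norm_greenSum_le hv p).trans hε
  have he : ∀ m x, e (m + 1, A m x + g m x) = A m (e (m, x)) - g m x := fun m x => by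
    rw [sub_eq_add_neg]
    exact hΓ.greenSum_apply_map hΦ hv (m, x)
  -- `(Id + e) ∘ (Id + f) - Id` is a bounded homogeneous solution over the linear dynamics.
  have hef : ∀ m x, f (m, x) + e (m, x + f (m, x)) = 0 := fun m x => by
    refine hΓ.eq_zero_of_norm_le (w := fun p => f p + e (p.1, p.2 + f p)) (u := 0) hη hΨ
      (fun p => norm_add_le_of_le (f.norm_coe_le_norm p) (heε _)) (fun p => ?_)
      (fun p => by simp; positivity) (m, x)
    have h1 : f (Ψ p) = A p.1 (f p) + g p.1 (p.2 + f p) := hf p.1 p.2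
    have h2 : (Ψ p).2 + f (Ψ p) = A p.1 (p.2 + f p) + g p.1 (p.2 + f p) := by
      rw [h1, map_add, add_assoc]
      rfl
    change f (Ψ p) + e (p.1 + 1, (Ψ p).2 + f (Ψ p)) = A p.1 (f p + e (p.1, p.2 + f p)) + 0
    rw [h2, he, h1, map_add]
    abel
  -- For `(Id + f) ∘ (Id + e) - Id` over the perturbed dynamics, the source is an increment of `g`.
  have hfe : ∀ m x, e (m, x) + f (m, x + e (m, x)) = 0 := fun m x => by
    refine hΓ.eq_zero_of_norm_le (w := fun p => e p + f (p.1, p.2 + e p))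
      (u := fun p => g p.1 (p.2 + (e p + f (p.1, p.2 + e p))) - g p.1 p.2) hη hΦ
      (fun p => norm_add_le_of_le (heε _) (f.norm_coe_le_norm _)) (fun p => ?_)
      (fun p => by simpa using hgη p.1 (p.2 + (e p + f (p.1, p.2 + e p))) p.2) (m, x)
    have h1 : e (Φ p) = A p.1 (e p) - g p.1 p.2 := he p.1 p.2
    have h2 : (Φ p).2 + e (Φ p) = A p.1 (p.2 + e p) := by
      change A p.1 p.2 + g p.1 p.2 + e (Φ p) = _
      rw [h1, map_add]
      abel
    change e (Φ p) + f (p.1 + 1, (Φ p).2 + e (Φ p)) = A p.1 (e p + f (p.1, p.2 + e p))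
      + (g p.1 (p.2 + (e p + f (p.1, p.2 + e p))) - g p.1 p.2)
    rw [h2, hf, h1, map_add, add_assoc p.2]
    abel
  refine ⟨fun m =>
    { toFun := fun x => x + e (m, x)
      invFun := fun x => x + f (m, x)
      left_inv := fun x => by beta_reduce; rw [add_assoc, hfe, add_zero]
      right_inv := fun x => by beta_reduce; rw [add_assoc, hef, add_zero]
      continuous_toFun := continuous_id.add (hec.comp (Continuous.prodMk_right m))
      continuous_invFun := continuous_id.add (f.continuous.comp (Continuous.prodMk_right m)) },
    fun m => ⟨fun x => ?_, fun x => ?_⟩, fun h hh => ?_⟩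
  · change A m x + g m x + e (m + 1, A m x + g m x) = A m (x + e (m, x))
    rw [he, map_add]
    abel
  · change ‖x + e (m, x) - x‖ ≤ ε
    rw [add_sub_cancel_left]
    exact heε _
  · ext m x
    change h m x = x + e (m, x)
    rw [← sub_eq_iff_eq_add']
    refine hΓ.eq_greenSum (w := fun p => h p.1 p.2 - p.2) hΦ (fun p => (hh p.1).2 p.2)
      (fun p => ?_) (m, x)
    simp only [hΦ', (hh p.1).1, map_sub, v]
    abel

end Conjugacy

/-! ### The nonautonomous Grobman–Hartman theorem -/

theorem theorem4p1 {X : Type*} [NormedAddCommGroup X] [NormedSpace ℝ X] [CompleteSpace X]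
    (A : ℤ → X ≃L[ℝ] X)
    (hA : BddAbove (Set.range fun m => ‖(A m : X →L[ℝ] X)‖))
    (hED : HasExponentialDichotomy A) :
    (∃ c : ℝ, IsRobustnessConstant A c) ∧
    ∀ c : ℝ, IsRobustnessConstant A c → ∀ D > (0 : ℝ), ∀ r > (0 : ℝ),
      ∃ L > (0 : ℝ), ∃ ε₀ > (0 : ℝ), ∀ ε : ℝ, 0 < ε → ε ≤ ε₀ →
        ∀ g : ℤ → X → X,
          (∀ n, Differentiable ℝ (g n)) →
          (∀ n x, ‖fderiv ℝ (g n) x‖ ≤ c / 2) →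
          (∀ n x y, ‖fderiv ℝ (g n) x - fderiv ℝ (g n) y‖ ≤ D * ‖x - y‖ ^ r) →
          (∀ n x, ‖g n x‖ ≤ L * ε) →
            (BddAbove (Set.range fun m => ‖((A m).symm : X →L[ℝ] X)‖) →
              ∀ n, IsHomeomorph fun x => A n x + g n x) ∧
            ((∀ n, IsHomeomorph fun x => A n x + g n x) →
              ∃! h : ℤ → X ≃ₜ X, ∀ m : ℤ,
                (∀ x, h (m + 1) (A m x + g m x) = A m (h m x)) ∧
                (∀ x, ‖h m x - x‖ ≤ ε)) := by
  obtain ⟨Γ, b, hΓ⟩ := hED.exists_isGreenKernel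
  refine ⟨hΓ.exists_isRobustnessConstant hA, fun c _ D hD r hr => ?_⟩
  have hM : 0 ≤ ∑' k, b k := tsum_nonneg hΓ.bound_nonneg
  obtain ⟨a, ha0, ha⟩ : ∃ a : ℝ, 0 ≤ a ∧
      (BddAbove (Set.range fun m => ‖((A m).symm : X →L[ℝ] X)‖) →
        ∀ m, ‖((A m).symm : X →L[ℝ] X)‖ ≤ a) := by
    by_cases h : BddAbove (Set.range fun m => ‖((A m).symm : X →L[ℝ] X)‖)
    · obtain ⟨a, ha⟩ := h
      exact ⟨a, (norm_nonneg _).trans (ha ⟨0, rfl⟩), fun _ m => ha ⟨m, rfl⟩⟩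
    · exact ⟨0, le_rfl, fun h' => absurd h' h⟩
  set M := ∑' k, b k
  -- A Lipschitz constant small enough both for the contraction and for the bijectivity of `A n + g n`.
  obtain ⟨η, hη0, hMη, haη⟩ : ∃ η : ℝ, 0 < η ∧ M * η ≤ 1 / 2 ∧ a * η < 1 := by
    refine ⟨1 / (2 * M + a + 1), by positivity, ?_, ?_⟩
    · rw [mul_one_div, div_le_div_iff₀ (by positivity) two_pos]
      linarith
    · rw [mul_one_div, div_lt_one (by positivity)]
      linarith
  lift η to ℝ≥0 using hη0.le
  obtain ⟨δ, hδ, hsmall⟩ := exists_norm_fderiv_le_of_norm_le (X := X) (Z := X) hD hr hη0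
  refine ⟨1 / (M + 1), by positivity, (M + 1) * δ, by positivity,
    fun ε hε hεδ g hgd _ hgD hgε => ?_⟩
  have hLε : 1 / (M + 1) * ε ≤ δ := by
    rw [one_div_mul_eq_div, div_le_iff₀' (by positivity)]
    exact hεδ
  have hgη : ∀ n x y, ‖g n x - g n y‖ ≤ η * ‖x - y‖ := fun n x y =>
    convex_univ.norm_image_sub_le_of_norm_fderiv_le (𝕜 := ℝ) (fun z _ => hgd n z)
      (fun z _ => hsmall (g n) (hgd n) (hgD n) (fun x => (hgε n x).trans hLε) z)
      (Set.mem_univ y) (Set.mem_univ x)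
  refine ⟨fun h n => isHomeomorph_add_of_norm_sub_le (A n) (hgη n) (ha h n) haη,
    hΓ.existsUnique_conj hMη ?_ hgε hgη fun n => (hgd n).continuous⟩
  rw [one_div_mul_eq_div, mul_div_assoc', div_le_iff₀ (by positivity)]
  nlinarith
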